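/- Let $\mathcal{SC}$ be the class of concave functions $\psi:\mathbb R\to[-\infty,\infty)$ that are proper, upper semicontinuous and satisfy $\psi(x)=\psi(-x)$, and let $\mathcal{SLC}_1$ be the class of probability densities on $\mathbb R$ of the form $e^{\psi}$ with $\psi\in\mathcal{SC}$ (where $e^{-\infty}=0$). Let $f^0\in\mathcal{SLC}_1$, $\pi^0\in(0,1)\setminus\{1/2\}$, $u_1^0\neq u_2^0$ real, and let $X_1,X_2,\dots$ be i.i.d. real random variables, on a probability space $(\Omega,\mathcal A,P)$, with density $g^0(x)=\pi^0f^0(x-u_1^0)+(1-\pi^0)f^0(x-u_2^0)$. For each $n$ let $\check\pi_n,\check u_{1,n},\check u_{2,n}$ be random variables on the same space (estimators of the mixing parameters) with $\check\pi_n\in(0,1)\setminus\{1/2\}$ and $\check u_{1,n}<\check u_{2,n}$, which are consistent: $\check\pi_n\to\pi^0$, $\check u_{1,n}\to u_1^0$ and $\check u_{2,n}\to u_2^0$ in probability. An MLE of the component density is a maximizer $\hat f_n$ over $\mathcal{SLC}_1$ of $$f\mapsto\sum_{j=1}^n\log\big(\check\pi_nf(X_j-\check u_{1,n})+(1-\check\pi_n)f(X_j-\check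 u_{2,n})\big)\qquad(\log 0=-\infty),$$ and the corresponding MLE of the mixed density is $\hat g_n=\check\pi_n\hat f_n(\cdot-\check u_{1,n})+(1-\check\pi_n)\hat f_n(\cdot-\check u_{2,n})$. Then the sup norm $\|\hat g_n\|_\infty=\sup_{x\in\mathbb R}|\hat g_n(x)|$ is bounded in probability: for every $\varepsilon>0$ there are an integer $n_0>0$ and a real $D>0$ such that $$P\big(\|\hat g_n\|_\infty\le D\big)\ge 1-\varepsilon\qquad\text{for all } n\ge n_0 .$$ Precisely, for every $n\ge n_0$ there is a measurable event $A_n$ with $P(A_n)\ge1-\varepsilon$ on which every mixed-density MLE $\hat g_n$ satisfies $\|\hat g_n\|_\infty\le D$ (no uniqueness or measurable selection of the MLE is assumed). -/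

import Mathlib

open MeasureTheory ProbabilityTheory Filter Topology
open scoped ENNReal

/-- The class `SC` of zero-symmetric concave functions `ψ : ℝ → [-∞, ∞)` that are proper (nowhere
`+∞` and not identically `-∞`) and upper semicontinuous. Concavity of an extended-real valued
function is convexity of its hypograph. -/
def SymConcave : Set (ℝ → EReal) :=
  {ψ | Convex ℝ {p : ℝ × ℝ | (p.2 : EReal) ≤ ψ p.1} ∧
    UpperSemicontinuous ψ ∧
    (∀ x, ψ x ≠ ⊤) ∧ (∃ x, ψ x ≠ ⊥) ∧
    ∀ x, ψ x = ψ (-x)}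

/-- The class `SLC = {exp ψ : ψ ∈ SC}`, with `exp (-∞) = 0`. -/
noncomputable def SymLogConcave : Set (ℝ → ℝ) :=
  {f | ∃ ψ ∈ SymConcave, f = fun x => (EReal.exp (ψ x)).toReal}

/-- The class `SLC₁` of zero-symmetric log-concave probability densities. -/
noncomputable def SymLogConcaveDensity : Set (ℝ → ℝ) :=
  SymLogConcave ∩ {f | ∫ x, f x = 1}

/-- The two-component location mixture `x ↦ p f(x - u₁) + (1 - p) f(x - u₂)`. -/
def locMixture (p u₁ u₂ : ℝ) (f : ℝ → ℝ) : ℝ → ℝ :=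
  fun x => p * f (x - u₁) + (1 - p) * f (x - u₂)

/-- The log-likelihood `∑_{j < n} log (g (x_j))` of a nonnegative function `g` at the data
`x_0, …, x_{n-1}`, with the convention `log 0 = -∞`. -/
noncomputable def logLikelihood (n : ℕ) (x : ℕ → ℝ) (g : ℝ → ℝ) : EReal :=
  ∑ j ∈ Finset.range n, ENNReal.log (ENNReal.ofReal (g (x j)))

/-- `f` is an MLE of the component density from the data `x_0, …, x_{n-1}`, for given values
`p, u₁, u₂` of the mixing parameters: it maximizes the log-likelihood of the mixture
over `SLC₁`. -/
def IsComponentMLE (n : ℕ) (x : ℕ → ℝ) (p u₁ u₂ : ℝ) (f : ℝ → ℝ) : Prop :=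
  f ∈ SymLogConcaveDensity ∧
    IsMaxOn (fun h => logLikelihood n x (locMixture p u₁ u₂ h)) SymLogConcaveDensity f

/-- `g` is an MLE of the mixed density: the mixture built from an MLE of the component. -/
def IsMixedMLE (n : ℕ) (x : ℕ → ℝ) (p u₁ u₂ : ℝ) (g : ℝ → ℝ) : Prop :=
  ∃ f, IsComponentMLE n x p u₁ u₂ f ∧ g = locMixture p u₁ u₂ f

/-- The sup norm (a true supremum over all points), with values in `[0, ∞]`. -/
noncomputable def supNorm (g : ℝ → ℝ) : ℝ≥0∞ := ⨆ x, ‖g x‖ₑ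

namespace SymConcave

variable {ψ : ℝ → EReal}

theorem apply_lineMap_ge (hψ : ψ ∈ SymConcave) {x y r s t : ℝ} (hx : (r : EReal) ≤ ψ x)
    (hy : (s : EReal) ≤ ψ y) (h0 : 0 ≤ t) (h1 : t ≤ 1) :
    (((1 - t) * r + t * s : ℝ) : EReal) ≤ ψ ((1 - t) * x + t * y) := by
  have h := hψ.1 (x := (x, r)) hx (y := (y, s)) hy (sub_nonneg.2 h1) h0 (by ring)
  simpa using h

theorem ge_of_abs_le (hψ : ψ ∈ SymConcave) {x y r : ℝ} (hx : (r : EReal) ≤ ψ x)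
    (hyx : |y| ≤ x) : (r : EReal) ≤ ψ y := by
  obtain ⟨h1, h2⟩ := abs_le.1 hyx
  rcases eq_or_lt_of_le ((abs_nonneg y).trans hyx) with h | h
  · obtain rfl : y = x := by linarith
    exact hx
  · have hx' : (r : EReal) ≤ ψ (-x) := by rwa [← hψ.2.2.2.2 x]
    have := apply_lineMap_ge hψ hx' hx (t := (y + x) / (2 * x)) (by apply div_nonneg <;> linarith)
      (by rw [div_le_one (by linarith)]; linarith)
    convert this using 2
    · ring
    · field_simp
      ring

end SymConcave

namespace SymLogConcaveDensity

variable {f : ℝ → ℝ}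

theorem nonneg (hf : f ∈ SymLogConcaveDensity) (x : ℝ) : 0 ≤ f x := by
  obtain ⟨⟨ψ, -, rfl⟩, -⟩ := hf
  exact ENNReal.toReal_nonneg

theorem integrable (hf : f ∈ SymLogConcaveDensity) : Integrable f := by
  by_contra h
  have h1 : ∫ x, f x = 1 := hf.2
  simp [integral_undef h] at h1

theorem comp_abs (hf : f ∈ SymLogConcaveDensity) (x : ℝ) : f |x| = f x := by
  obtain ⟨⟨ψ, hψ, rfl⟩, -⟩ := hf
  rcases abs_choice x with h | h
  · rw [h]
  · simp only [h, ← hψ.2.2.2.2 x]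

theorem exp_le_apply_iff {ψ : ℝ → EReal} (hψ : ψ ∈ SymConcave) {x r : ℝ} :
    Real.exp r ≤ (EReal.exp (ψ x)).toReal ↔ (r : EReal) ≤ ψ x := by
  have ht := hψ.2.2.1 x
  induction h : ψ x with
  | bot => simp [Real.exp_pos]
  | top => exact absurd h ht
  | coe s => simp [EReal.exp_coe, ENNReal.toReal_ofReal (Real.exp_pos s).le]

theorem le_of_abs_le (hf : f ∈ SymLogConcaveDensity) {x y : ℝ} (hxy : |y| ≤ |x|) : f x ≤ f y := by
  have h0 := nonneg hf y
  rw [← comp_abs hf x]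
  obtain ⟨⟨ψ, hψ, rfl⟩, -⟩ := hf
  dsimp only at *
  by_contra! h
  have hpos := h0.trans_lt h
  obtain ⟨r, hr⟩ : ∃ r, Real.exp r = (EReal.exp (ψ |x|)).toReal := ⟨_, Real.exp_log hpos⟩
  have h2 := SymConcave.ge_of_abs_le hψ ((exp_le_apply_iff hψ).1 hr.le) hxy
  have := (exp_le_apply_iff hψ).2 h2
  linarith

theorem le_apply_zero (hf : f ∈ SymLogConcaveDensity) (x : ℝ) : f x ≤ f 0 :=
  le_of_abs_le hf (by simp)

theorem apply_zero_pos (hf : f ∈ SymLogConcaveDensity) : 0 < f 0 := by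
  by_contra! h
  have h0 : f = 0 := funext fun x => le_antisymm ((le_apply_zero hf x).trans h) (nonneg hf x)
  have h1 : ∫ x, f x = 1 := hf.2
  simp [h0] at h1

theorem two_mul_mul_apply_le (hf : f ∈ SymLogConcaveDensity) {x : ℝ} (hx : 0 ≤ x) :
    2 * x * f x ≤ 1 := by
  have h1 : ∫ y, f y = 1 := hf.2
  calc 2 * x * f x = ∫ y in Set.Icc (-x) x, f x := by
        rw [setIntegral_const, Real.volume_real_Icc_of_le (by linarith), smul_eq_mul]
        ring
    _ ≤ ∫ y in Set.Icc (-x) x, f y := by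
        refine setIntegral_mono_on (by simp) (integrable hf).integrableOn measurableSet_Icc ?_
        intro y hy
        exact le_of_abs_le hf (by rw [abs_of_nonneg hx]; exact abs_le.2 hy)
    _ ≤ ∫ y, f y := setIntegral_le_integral (integrable hf) (ae_of_all _ (nonneg hf))
    _ = 1 := h1

/-- A symmetric log-concave density decays exponentially, at a rate set by its maximum. -/
theorem le_exp (hf : f ∈ SymLogConcaveDensity) (x : ℝ) :
    f x ≤ f 0 * Real.exp (1 - f 0 * |x| / 2) := by
  have hM := apply_zero_pos hf
  have hb := two_mul_mul_apply_le hf (x := 2 / f 0) (by positivity)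
  have hle := le_apply_zero hf x
  rcases le_or_gt |x| (2 / f 0) with hx | hx
  · have h1 : 1 ≤ Real.exp (1 - f 0 * |x| / 2) := by
      rw [Real.one_le_exp_iff]
      rw [le_div_iff₀ hM] at hx
      linarith
    nlinarith
  have hx0 : 0 < |x| := (by positivity : 0 < 2 / f 0).trans hx
  rcases eq_or_lt_of_le (nonneg hf x) with h0 | h0
  · rw [← h0]; positivity
  rw [← comp_abs hf x] at h0 ⊢
  obtain ⟨m, hm⟩ : ∃ m, Real.exp m = f 0 := ⟨_, Real.exp_log hM⟩
  obtain ⟨r, hr⟩ : ∃ r, Real.exp r = f |x| := ⟨_, Real.exp_log h0⟩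
  have ht0 : 0 < 2 / f 0 / |x| := by positivity
  have ht1 : 2 / f 0 / |x| ≤ 1 := by rw [div_le_one hx0]; exact hx.le
  have key : Real.exp ((1 - 2 / f 0 / |x|) * m + 2 / f 0 / |x| * r) ≤ f (2 / f 0) := by
    obtain ⟨⟨ψ, hψ, rfl⟩, -⟩ := hf
    dsimp only at *
    rw [exp_le_apply_iff hψ]
    have := SymConcave.apply_lineMap_ge hψ ((exp_le_apply_iff hψ).1 hm.le)
      ((exp_le_apply_iff hψ).1 hr.le) ht0.le ht1
    convert this using 2
    field_simp
    ring
  have hquarter : f (2 / f 0) ≤ Real.exp (m - 1) := by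
    have h4 : f (2 / f 0) ≤ f 0 / 4 := by
      have : 2 * (2 / f 0) * f (2 / f 0) = f (2 / f 0) * 4 / f 0 := by ring
      rw [this, div_le_one hM] at hb
      linarith
    rw [Real.exp_sub, hm]
    refine h4.trans (div_le_div_of_nonneg_left hM.le (Real.exp_pos 1) ?_)
    have := Real.exp_one_lt_d9
    linarith
  have h3 := Real.exp_le_exp.1 (key.trans hquarter)
  rw [← hm, ← hr, ← Real.exp_add, Real.exp_le_exp]
  have h5 : 2 / f 0 / |x| * (r - m) ≤ -1 := by linarith
  have h6 : r - m ≤ -(Real.exp m * |x| / 2) := by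
    rw [← le_div_iff₀' ht0] at h5
    refine h5.trans (le_of_eq ?_)
    rw [hm]
    field_simp
  linarith

end SymLogConcaveDensity

/-- The Laplace density, a symmetric log-concave density that vanishes nowhere. -/
noncomputable def laplaceDensity (x : ℝ) : ℝ := Real.exp (-|x| - Real.log 2)

theorem laplaceDensity_mem : laplaceDensity ∈ SymLogConcaveDensity := by
  refine ⟨⟨fun x => ((-|x| - Real.log 2 : ℝ) : EReal), ⟨?_, ?_, ?_, ?_, ?_⟩, ?_⟩, ?_⟩
  · have h : ConcaveOn ℝ Set.univ fun x : ℝ => -|x| - Real.log 2 :=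
      (convexOn_univ_norm (E := ℝ)).neg.sub (convexOn_const _ convex_univ)
    simpa only [EReal.coe_le_coe_iff, Set.mem_univ, true_and] using h.convex_hypograph
  · exact (continuous_coe_real_ereal.comp (by fun_prop)).upperSemicontinuous
  · exact fun x => EReal.coe_ne_top _
  · exact ⟨0, EReal.coe_ne_bot _⟩
  · simp
  · funext x
    simp only [laplaceDensity, EReal.exp_coe, ENNReal.toReal_ofReal (Real.exp_pos _).le]
  · have h := integral_comp_abs (f := fun x => Real.exp (-x - Real.log 2))
    simp only [Set.mem_ofPred_eq, laplaceDensity]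
    rw [h]
    simp only [Real.exp_sub, Real.exp_log two_pos, integral_div, integral_exp_neg_Ioi_zero]
    norm_num

section Mixture

variable {p a b x : ℝ} {f : ℝ → ℝ}

theorem locMixture_le {c : ℝ} (hp0 : 0 ≤ p) (hp1 : p ≤ 1) (ha : f (x - a) ≤ c)
    (hb : f (x - b) ≤ c) : locMixture p a b f x ≤ c := by
  unfold locMixture
  nlinarith

theorem le_locMixture {c : ℝ} (hp0 : 0 ≤ p) (hp1 : p ≤ 1) (ha : c ≤ f (x - a))
    (hb : c ≤ f (x - b)) : c ≤ locMixture p a b f x := by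
  unfold locMixture
  nlinarith

theorem supNorm_locMixture_le (hp0 : 0 ≤ p) (hp1 : p ≤ 1) (hf : f ∈ SymLogConcaveDensity) :
    supNorm (locMixture p a b f) ≤ ENNReal.ofReal (f 0) := by
  refine iSup_le fun x => ?_
  rw [Real.enorm_eq_ofReal (le_locMixture hp0 hp1 (SymLogConcaveDensity.nonneg hf _)
    (SymLogConcaveDensity.nonneg hf _))]
  exact ENNReal.ofReal_le_ofReal (locMixture_le hp0 hp1
    (SymLogConcaveDensity.le_apply_zero hf _) (SymLogConcaveDensity.le_apply_zero hf _))

theorem EReal.coe_finset_sum {ι : Type*} (s : Finset ι) (r : ι → ℝ) :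
    ((∑ j ∈ s, r j : ℝ) : EReal) = ∑ j ∈ s, (r j : EReal) :=
  map_sum (⟨⟨Real.toEReal, EReal.coe_zero⟩, EReal.coe_add⟩ : ℝ →+ EReal) r s

theorem logLikelihood_le_sum {n : ℕ} {x : ℕ → ℝ} {g : ℝ → ℝ} {r : ℕ → ℝ}
    (h : ∀ j, g (x j) ≤ Real.exp (r j)) :
    logLikelihood n x g ≤ ((∑ j ∈ Finset.range n, r j : ℝ) : EReal) := by
  rw [logLikelihood, EReal.coe_finset_sum]
  refine Finset.sum_le_sum fun j _ => ?_
  rw [← EReal.log_exp (r j), EReal.exp_coe]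
  exact ENNReal.log_monotone (ENNReal.ofReal_le_ofReal (h j))

theorem sum_le_logLikelihood {n : ℕ} {x : ℕ → ℝ} {g : ℝ → ℝ} {r : ℕ → ℝ}
    (h : ∀ j, Real.exp (r j) ≤ g (x j)) :
    ((∑ j ∈ Finset.range n, r j : ℝ) : EReal) ≤ logLikelihood n x g := by
  rw [logLikelihood, EReal.coe_finset_sum]
  refine Finset.sum_le_sum fun j _ => ?_
  rw [← EReal.log_exp (r j), EReal.exp_coe]
  exact ENNReal.log_monotone (ENNReal.ofReal_le_ofReal (h j))

/-- Comparison of the maximum likelihood estimator with the Laplace density. -/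
theorem IsComponentMLE.sum_min_le {n : ℕ} {x : ℕ → ℝ} (hp0 : 0 ≤ p) (hp1 : p ≤ 1) (hab : a ≤ b)
    (hf : IsComponentMLE n x p a b f) :
    (f 0 / 2 - 1) * ∑ j ∈ Finset.range n, min |x j - a| |x j - b| ≤
      n * (Real.log (f 0) + 1 + Real.log 2 + (b - a)) := by
  have hM := SymLogConcaveDensity.apply_zero_pos hf.1
  have hupper : logLikelihood n x (locMixture p a b f) ≤ ((∑ j ∈ Finset.range n,
      (Real.log (f 0) + (1 - f 0 * min |x j - a| |x j - b| / 2)) : ℝ) : EReal) := by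
    refine logLikelihood_le_sum fun j => ?_
    rw [Real.exp_add, Real.exp_log hM]
    apply locMixture_le hp0 hp1 <;> refine (SymLogConcaveDensity.le_exp hf.1 _).trans ?_ <;> gcongr
    · exact min_le_left _ _
    · exact min_le_right _ _
  have hlower : ((∑ j ∈ Finset.range n,
      (-(min |x j - a| |x j - b| + (b - a)) - Real.log 2) : ℝ) : EReal) ≤
      logLikelihood n x (locMixture p a b laplaceDensity) := by
    refine sum_le_logLikelihood fun j => ?_
    apply le_locMixture hp0 hp1 <;> refine Real.exp_le_exp.2 ?_ <;> gcongr
    · rw [← min_add_add_right, le_min_iff]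
      refine ⟨by linarith, ?_⟩
      have := abs_add_le (x j - b) (b - a)
      rw [abs_of_nonneg (sub_nonneg.2 hab)] at this
      simpa using this
    · rw [← min_add_add_right, le_min_iff]
      refine ⟨?_, by linarith⟩
      have := abs_sub (x j - a) (b - a)
      rw [abs_of_nonneg (sub_nonneg.2 hab)] at this
      simpa using this
  have h := EReal.coe_le_coe_iff.1 (hlower.trans ((hf.2 laplaceDensity_mem).trans hupper))
  simp only [Finset.sum_add_distrib, Finset.sum_sub_distrib, Finset.sum_neg_distrib,
    Finset.sum_const, Finset.card_range, nsmul_eq_mul, ← Finset.sum_div, ← Finset.mul_sum] at h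
  linarith

theorem le_of_mul_le_log_add {M κ C : ℝ} (hM : 0 < M) (hκ : 0 < κ)
    (h : (M / 2 - 1) * κ ≤ Real.log M + C) :
    M ≤ 4 / κ * (κ + |C| + |Real.log (4 / κ)|) := by
  have h1 := Real.log_le_sub_one_of_pos (show 0 < M / (4 / κ) by positivity)
  rw [Real.log_div hM.ne' (by positivity)] at h1
  have h2 : M / (4 / κ) = M * κ / 4 := by field_simp
  rw [h2] at h1
  have h3 := le_abs_self C
  have h4 := le_abs_self (Real.log (4 / κ))
  rw [div_mul_eq_mul_div, le_div_iff₀ hκ]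
  linarith

theorem IsComponentMLE.apply_zero_le {n : ℕ} {x : ℕ → ℝ} {κ B : ℝ} (hn : 0 < n) (hp0 : 0 ≤ p)
    (hp1 : p ≤ 1) (hab : a ≤ b) (hB : b - a ≤ B) (hκ : 0 < κ)
    (hsum : n * κ ≤ ∑ j ∈ Finset.range n, min |x j - a| |x j - b|)
    (hf : IsComponentMLE n x p a b f) :
    f 0 ≤ max 2 (4 / κ * (κ + |1 + Real.log 2 + B| + |Real.log (4 / κ)|)) := by
  have hM := SymLogConcaveDensity.apply_zero_pos hf.1
  rcases le_or_gt (f 0) 2 with h2 | h2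
  · exact le_max_of_le_left h2
  refine le_max_of_le_right (le_of_mul_le_log_add hM hκ ?_)
  have h := hf.sum_min_le hp0 hp1 hab
  have hn' : (0 : ℝ) < n := by exact_mod_cast hn
  refine le_of_mul_le_mul_left ?_ hn'
  calc n * ((f 0 / 2 - 1) * κ) = (f 0 / 2 - 1) * (n * κ) := by ring
    _ ≤ _ := mul_le_mul_of_nonneg_left hsum (by linarith)
    _ ≤ _ := h
    _ ≤ _ := mul_le_mul_of_nonneg_left (by linarith) hn'.le

/-- A random variable whose density is a mixture is close to `a` or `b` with small probability. -/
theorem withDensity_locMixture_min_le (hp0 : 0 ≤ p) (hp1 : p ≤ 1) (hf : f ∈ SymLogConcaveDensity)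
    (r : ℝ) :
    volume.withDensity (fun x => ENNReal.ofReal (locMixture p a b f x))
      {x | min |x - a| |x - b| ≤ r} ≤ ENNReal.ofReal (4 * f 0 * r) := by
  have hM := SymLogConcaveDensity.apply_zero_pos hf
  have hset : {x : ℝ | min |x - a| |x - b| ≤ r} = Metric.closedBall a r ∪ Metric.closedBall b r := by
    ext x
    simp [Real.dist_eq]
  rw [hset, withDensity_apply _ (Metric.isClosed_closedBall.measurableSet.union
    Metric.isClosed_closedBall.measurableSet)]
  calc _ ≤ ∫⁻ _ in Metric.closedBall a r ∪ Metric.closedBall b r, ENNReal.ofReal (f 0) :=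
        lintegral_mono fun x => ENNReal.ofReal_le_ofReal (locMixture_le hp0 hp1
          (SymLogConcaveDensity.le_apply_zero hf _) (SymLogConcaveDensity.le_apply_zero hf _))
    _ ≤ ENNReal.ofReal (f 0) * (volume (Metric.closedBall a r) + volume (Metric.closedBall b r)) := by
        rw [setLIntegral_const]
        gcongr
        exact measure_union_le _ _
    _ = _ := by
        rw [Real.volume_closedBall, Real.volume_closedBall, ← two_mul,
          show (2 : ℝ≥0∞) = ENNReal.ofReal 2 by simp, ← ENNReal.ofReal_mul two_pos.le,
          ← ENNReal.ofReal_mul hM.le]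
        congr 1
        ring

end Mixture

/-- Markov's inequality for the number of events that occur. -/
theorem measure_half_le_sum_indicator {Ω : Type*} [MeasurableSpace Ω] (P : Measure Ω)
    {B : ℕ → Set Ω} (hB : ∀ j, MeasurableSet (B j)) {q : ℝ≥0∞} (hq : ∀ j, P (B j) ≤ q) {n : ℕ}
    (hn : 0 < n) :
    P {ω | (n : ℝ≥0∞) / 2 ≤ ∑ j ∈ Finset.range n, (B j).indicator 1 ω} ≤ 2 * q := by
  have hmeas : Measurable fun ω => ∑ j ∈ Finset.range n, (B j).indicator (1 : Ω → ℝ≥0∞) ω :=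
    Finset.measurable_sum _ fun j _ => measurable_one.indicator (hB j)
  have hn0 : (n : ℝ≥0∞) ≠ 0 := by exact_mod_cast hn.ne'
  refine (meas_ge_le_lintegral_div hmeas.aemeasurable (by simp [hn0])
    (ENNReal.div_ne_top (by simp) (by simp))).trans ?_
  rw [lintegral_finsetSum _ fun j _ => measurable_one.indicator (hB j)]
  simp only [lintegral_indicator_one (hB _)]
  refine ENNReal.div_le_of_le_mul ?_
  calc _ ≤ ∑ j ∈ Finset.range n, q := Finset.sum_le_sum fun j _ => hq j
    _ = n * q := by simp
    _ = 2 * q * (n / 2) := by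
      rw [mul_comm (2 : ℝ≥0∞) q, mul_assoc, ENNReal.mul_div_cancel (by simp) (by simp), mul_comm]

theorem mul_half_le_sum_of_sum_indicator_lt {Ω : Type*} {B : ℕ → Set Ω} {ω : Ω} {n : ℕ}
    {d : ℕ → ℝ} {η : ℝ} (hη : 0 ≤ η) (hd : ∀ j, 0 ≤ d j) (hdB : ∀ j, ω ∉ B j → η ≤ d j)
    (h : ∑ j ∈ Finset.range n, (B j).indicator (1 : Ω → ℝ≥0∞) ω < n / 2) :
    n * (η / 2) ≤ ∑ j ∈ Finset.range n, d j := by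
  have hreal : ∑ j ∈ Finset.range n, (B j).indicator (1 : Ω → ℝ) ω ≤ n / 2 := by
    have h1 := ENNReal.toReal_mono (ENNReal.div_ne_top (by simp) (by simp)) h.le
    rw [ENNReal.toReal_sum (fun j _ => by by_cases hj : ω ∈ B j <;> simp [hj])] at h1
    simp only [ENNReal.toReal_div, ENNReal.toReal_natCast, ENNReal.toReal_ofNat] at h1
    refine le_trans (Finset.sum_le_sum fun j _ => ?_) h1
    by_cases hj : ω ∈ B j <;> simp [hj]
  calc n * (η / 2) ≤ ∑ j ∈ Finset.range n, η * (1 - (B j).indicator (1 : Ω → ℝ) ω) := by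
        rw [← Finset.mul_sum, Finset.sum_sub_distrib]
        simp only [Finset.sum_const, Finset.card_range, nsmul_eq_mul, mul_one]
        nlinarith
    _ ≤ _ := by
        refine Finset.sum_le_sum fun j _ => ?_
        by_cases hj : ω ∈ B j
        · simp [hj, hd j]
        · simpa [hj] using hdB j hj

theorem mainTheorem8 {Ω : Type*} [MeasurableSpace Ω] (P : Measure Ω) [IsProbabilityMeasure P]
    -- the true model
    (p₀ a₀ b₀ : ℝ) (f₀ : ℝ → ℝ)
    (hp₀ : p₀ ∈ Set.Ioo (0 : ℝ) 1 \ {1 / 2}) (hab₀ : a₀ ≠ b₀)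
    (hf₀ : f₀ ∈ SymLogConcaveDensity)
    -- i.i.d. observations with density `g₀ = p₀ f₀(· - a₀) + (1 - p₀) f₀(· - b₀)`
    (X : ℕ → Ω → ℝ) (hXm : ∀ i, Measurable (X i)) (hXindep : iIndepFun X P)
    (hXlaw : ∀ i, P.map (X i) =
      volume.withDensity (fun x => ENNReal.ofReal (locMixture p₀ a₀ b₀ f₀ x)))
    -- consistent estimators of the mixing parameters
    (p a b : ℕ → Ω → ℝ)
    (hpm : ∀ n, Measurable (p n)) (ham : ∀ n, Measurable (a n)) (hbm : ∀ n, Measurable (b n))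
    (hp : ∀ n ω, p n ω ∈ Set.Ioo (0 : ℝ) 1 \ {1 / 2}) (hab : ∀ n ω, a n ω < b n ω)
    (hpc : TendstoInMeasure P p atTop (fun _ => p₀))
    (hac : TendstoInMeasure P a atTop (fun _ => a₀))
    (hbc : TendstoInMeasure P b atTop (fun _ => b₀)) :
    ∀ ε : ℝ, 0 < ε → ∃ n₀ : ℕ, 0 < n₀ ∧ ∃ D : ℝ, 0 < D ∧ ∀ n ≥ n₀,
      ∃ A : Set Ω, MeasurableSet A ∧ ENNReal.ofReal (1 - ε) ≤ P A ∧
        ∀ ω ∈ A, ∀ g : ℝ → ℝ,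
          IsMixedMLE n (fun i => X i ω) (p n ω) (a n ω) (b n ω) g →
            supNorm g ≤ ENNReal.ofReal D := by
  intro ε hε
  have hp₀' : 0 ≤ p₀ ∧ p₀ ≤ 1 := ⟨hp₀.1.1.le, hp₀.1.2.le⟩
  have hM₀ := SymLogConcaveDensity.apply_zero_pos hf₀
  obtain ⟨η, hη, hηε⟩ : ∃ η : ℝ, 0 < η ∧ 2 * (4 * f₀ 0 * (2 * η)) = ε / 3 :=
    ⟨ε / (48 * f₀ 0), by positivity, by field_simp; norm_num⟩
  have hδ : 0 < min η 1 := lt_min hη one_pos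
  have hε3 : (0 : ℝ≥0∞) < ENNReal.ofReal (ε / 3) := ENNReal.ofReal_pos.2 (by positivity)
  have hae := (tendstoInMeasure_iff_dist.1 hac _ hδ).eventually_le_const hε3
  have hbe := (tendstoInMeasure_iff_dist.1 hbc _ hδ).eventually_le_const hε3
  obtain ⟨N, hN⟩ := eventually_atTop.1 (hae.and hbe)
  refine ⟨N + 1, N.succ_pos, max 2 (4 / (η / 2) * (η / 2 + |1 + Real.log 2 + (b₀ - a₀ + 2)| +
    |Real.log (4 / (η / 2))|)), lt_max_of_lt_left two_pos, fun n hn => ?_⟩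
  obtain ⟨hna, hnb⟩ := hN n (by omega)
  have hn0 : 0 < n := by omega
  set K : Set ℝ := {x | min |x - a₀| |x - b₀| ≤ 2 * η}
  have hK : MeasurableSet K :=
    (isClosed_le (by fun_prop) continuous_const).measurableSet
  have hB : ∀ j, MeasurableSet (X j ⁻¹' K) := fun j => hXm j hK
  have hPB : ∀ j, P (X j ⁻¹' K) ≤ ENNReal.ofReal (4 * f₀ 0 * (2 * η)) := fun j => by
    rw [← Measure.map_apply (hXm j) hK, hXlaw j]
    exact withDensity_locMixture_min_le hp₀'.1 hp₀'.2 hf₀ _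
  have hcount := measure_half_le_sum_indicator P hB hPB hn0
  rw [show (2 : ℝ≥0∞) = ENNReal.ofReal 2 by simp, ← ENNReal.ofReal_mul two_pos.le, hηε,
    show ENNReal.ofReal 2 = (2 : ℝ≥0∞) by simp] at hcount
  set E₁ : Set Ω := {ω | min η 1 ≤ dist (a n ω) a₀}
  set E₂ : Set Ω := {ω | min η 1 ≤ dist (b n ω) b₀}
  set E₃ : Set Ω := {ω | (n : ℝ≥0∞) / 2 ≤ ∑ j ∈ Finset.range n, (X j ⁻¹' K).indicator 1 ω}
  have hE₁ : MeasurableSet E₁ := measurableSet_le measurable_const ((ham n).dist measurable_const)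
  have hE₂ : MeasurableSet E₂ := measurableSet_le measurable_const ((hbm n).dist measurable_const)
  have hE₃ : MeasurableSet E₃ := measurableSet_le measurable_const
    (Finset.measurable_sum _ fun j _ => measurable_one.indicator (hB j))
  have hE := (hE₁.union hE₂).union hE₃
  refine ⟨(E₁ ∪ E₂ ∪ E₃)ᶜ, hE.compl, ?_, ?_⟩
  · rw [prob_compl_eq_one_sub hE, ENNReal.ofReal_sub _ hε.le, ENNReal.ofReal_one]
    refine tsub_le_tsub_left ?_ 1
    calc P (E₁ ∪ E₂ ∪ E₃) ≤ P E₁ + P E₂ + P E₃ :=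
          (measure_union_le _ _).trans (by gcongr; exact measure_union_le _ _)
      _ ≤ ENNReal.ofReal (ε / 3) + ENNReal.ofReal (ε / 3) + ENNReal.ofReal (ε / 3) := by gcongr
      _ = ENNReal.ofReal ε := by
          rw [← ENNReal.ofReal_add (by positivity) (by positivity),
            ← ENNReal.ofReal_add (by positivity) (by positivity)]
          congr 1
          ring
  · rintro ω hω g ⟨f, hf, rfl⟩
    simp only [E₁, E₂, E₃, Set.mem_compl_iff, Set.mem_union, Set.mem_ofPred_eq, not_or, not_le,
      Real.dist_eq, lt_min_iff] at hω
    obtain ⟨⟨⟨ha1, ha2⟩, hb1, hb2⟩, hc⟩ := hω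
    have hp' := (hp n ω).1
    refine (supNorm_locMixture_le hp'.1.le hp'.2.le hf.1).trans (ENNReal.ofReal_le_ofReal ?_)
    refine hf.apply_zero_le hn0 hp'.1.le hp'.2.le (hab n ω).le ?_ (by positivity) ?_
    · have := abs_lt.1 ha2
      have := abs_lt.1 hb2
      linarith
    · refine mul_half_le_sum_of_sum_indicator_lt hη.le (fun j => by positivity) (fun j hj => ?_) hc
      simp only [K, Set.mem_preimage, Set.mem_ofPred_eq, not_le, lt_min_iff] at hj
      have h1 := abs_sub_le (X j ω) (a n ω) a₀
      have h2 := abs_sub_le (X j ω) (b n ω) b₀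
      exact le_min (by linarith) (by linarith)
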